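/- Let $s\ge 2$ and let $d_1,\dots,d_s$ be integers with every $d_i>1$; put $d=\prod_{i=1}^s d_i$. For each prime $p$ let $h=\sum_{i=1}^s x_i^{d_i}\in A=(\mathbb{Z}/p)[x_1,\dots,x_s]$, and for $n\ge 0$ let $e_n(h)$ be the colength of the ideal $(h,x_1^{q},\dots,x_s^{q})$, $q=p^n$, that is, the length of the $A$-module $A/(h,x_1^{q},\dots,x_s^{q})$. Then for each prime $p$ the limit $\mu=\mu_p=\lim_{n\to\infty}e_n(h)/q^{s-1}$ (the Hilbert–Kunz multiplicity of $h$) exists, $\mu>0$, and $e_n(h)=\mu q^{s-1}+O(q^{s-2})$ as $n\to\infty$ with $p$ fixed; moreover $$\left|\frac{e_1(h)}{p^{s-1}}-\mu\right|\le\frac{ds}{p}.$$ Consequently, if $\lim_{p\to\infty}e_1(h)/p^{s-1}$ exists, where $p$ runs through the primes, then $\lim_{p\to\infty}\mu_p$ exists and $$\lim_{p\to\infty}\mu_p=\lim_{p\to\infty}\frac{e_1(h)}{p^{s-1}}.$$ -/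

import Mathlib

open Filter Topology Asymptotics

namespace HilbertKunz

/-- The ideal of `(ℤ/p)[x₁, …, x_s]` generated by `h` and the `x_i ^ q`, where `q = p ^ n`. -/
noncomputable def frobIdeal {p s : ℕ} (h : MvPolynomial (Fin s) (ZMod p)) (n : ℕ) :
    Ideal (MvPolynomial (Fin s) (ZMod p)) :=
  Ideal.span (insert h (Set.range fun i : Fin s => MvPolynomial.X i ^ p ^ n))

/-- The colength of an ideal `I` of `A`: the length of the `A`-module `A / I`. -/
noncomputable def colength {A : Type*} [CommRing A] (I : Ideal A) : ℕ∞ :=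
  Module.length A (A ⧸ I)

/-- For `p` prime the ideal generated by `h` and the `x_i ^ q` has finite colength, so that
nothing is lost by regarding its colength as a natural number. -/
theorem colength_frobIdeal_ne_top {p s : ℕ} (hp : p.Prime)
    (h : MvPolynomial (Fin s) (ZMod p)) (n : ℕ) : colength (frobIdeal h n) ≠ ⊤ := by
  have : Fact p.Prime := ⟨hp⟩
  set I := frobIdeal h n with hI
  have hint : ∀ i : Fin s, IsIntegral (ZMod p) (Ideal.Quotient.mkₐ (ZMod p) I (MvPolynomial.X i)) := by
    intro i
    refine IsIntegral.of_pow (n := p ^ n) (pow_pos hp.pos n) ?_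
    have h0 : (Ideal.Quotient.mkₐ (ZMod p) I (MvPolynomial.X i)) ^ p ^ n = 0 := by
      rw [← map_pow]
      exact Ideal.Quotient.eq_zero_iff_mem.mpr
        (Ideal.subset_span (Set.mem_insert_of_mem _ ⟨i, rfl⟩))
    rw [h0]
    exact isIntegral_zero
  have hfg := fg_adjoin_of_finite (R := ZMod p)
    (Set.finite_range fun i : Fin s => Ideal.Quotient.mkₐ (ZMod p) I (MvPolynomial.X i))
    (by rintro _ ⟨i, rfl⟩; exact hint i)
  have htop : Algebra.adjoin (ZMod p)
      (Set.range fun i : Fin s => Ideal.Quotient.mkₐ (ZMod p) I (MvPolynomial.X i)) = ⊤ := by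
    have h1 := AlgHom.map_adjoin (Ideal.Quotient.mkₐ (ZMod p) I)
      (Set.range (MvPolynomial.X : Fin s → MvPolynomial (Fin s) (ZMod p)))
    rw [MvPolynomial.adjoin_range_X, Algebra.map_top, ← Set.range_comp,
      (AlgHom.range_eq_top _).mpr (Ideal.Quotient.mkₐ_surjective _ _)] at h1
    exact h1.symm
  rw [htop] at hfg
  have : Module.Finite (ZMod p) (MvPolynomial (Fin s) (ZMod p) ⧸ I) := ⟨hfg⟩
  have : IsArtinian (MvPolynomial (Fin s) (ZMod p)) (MvPolynomial (Fin s) (ZMod p) ⧸ I) :=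
    isArtinian_of_tower (ZMod p) inferInstance
  exact Module.length_ne_top_iff.mpr
    (isFiniteLength_iff_isNoetherian_isArtinian.mpr ⟨inferInstance, inferInstance⟩)

/-- The Hilbert–Kunz function `e_n(h)`: the colength of the ideal generated by `h` and the
`x_i ^ q`, where `q = p ^ n`. -/
noncomputable def e {p s : ℕ} (n : ℕ) (h : MvPolynomial (Fin s) (ZMod p)) : ℕ :=
  (colength (frobIdeal h n)).toNat

/-- `μ` is a Hilbert–Kunz multiplicity of `h`: `μ > 0` and
`e_n(h) = μ q ^ (s - 1) + O(q ^ (s - 2))` as `n → ∞`, where `q = p ^ n`. It is used only for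
`s ≥ 2`; there is then at most one such `μ`. -/
def IsMultiplicity {p s : ℕ} (h : MvPolynomial (Fin s) (ZMod p)) (μ : ℝ) : Prop :=
  0 < μ ∧
    (fun n : ℕ => (e n h : ℝ) - μ * ((p : ℝ) ^ n) ^ (s - 1)) =O[atTop]
      (fun n : ℕ => ((p : ℝ) ^ n) ^ (s - 2))

/-- The Hilbert–Kunz multiplicity of `h`: the limit of `e_n(h) / q ^ (s - 1)` as `n → ∞`. -/
noncomputable def multiplicity {p s : ℕ} (h : MvPolynomial (Fin s) (ZMod p)) : ℝ :=
  limUnder atTop fun n : ℕ => (e n h : ℝ) / ((p : ℝ) ^ n) ^ (s - 1)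

/-- The element `∑ x_i ^ d_i` of `(ℤ/p)[x₁, …, x_s]`. -/
noncomputable def diagonal (p : ℕ) {s : ℕ} (d : Fin s → ℕ) : MvPolynomial (Fin s) (ZMod p) :=
  ∑ i, MvPolynomial.X i ^ d i

/-- `p → ∞` through the prime numbers. -/
def primesAtTop : Filter ℕ := atTop ⊓ 𝓟 {p : ℕ | p.Prime}

end HilbertKunz

/-!
The substitution `x_i ↦ x_i ^ d_i` makes the polynomial ring free of rank `d = ∏ d_i` over itself,
so that `e_n` of `∑ x_i ^ d_i` lies between `d · D(⌊q / d_i⌋)` and `d · D(⌈q / d_i⌉)`, where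
`D(b)` is the dimension of `k[x] / (∑ x_i, x_i ^ b_i)`. Eliminating one variable turns this
quotient into `k[x_1, …, x_{s-1}] / (x_j ^ b_j, (∑ x_j) ^ b_s)`, whose defining ideal is generated
by powers of linear forms over the prime field; the substitution `x_j ↦ x_j ^ p` then gives
`D(p b) = p ^ (s - 1) D(b)`. Hence, after division by `q ^ (s - 1)`, the lower bounds increase and
the upper bounds decrease with `n`. Raising a single `b_i ≤ q` by one raises `D(b)` by at most
`q ^ (s - 2)`, so the two bounds are at distance at most `d s / q`, and both converge to `μ`.
-/

namespace HilbertKunz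

open MvPolynomial Module

section Quotient

variable {k A B : Type*} [Field k] [CommRing A] [Algebra k A] [CommRing B] [Algebra k B]

theorem finrank_quotient_anti {I J : Ideal A} [Module.Finite k (A ⧸ I)] (h : I ≤ J) :
    finrank k (A ⧸ J) ≤ finrank k (A ⧸ I) :=
  LinearMap.finrank_le_finrank_of_surjective (f := (Ideal.Quotient.factorₐ k h).toLinearMap)
    (Ideal.Quotient.factor_surjective h)

-- Multiplication by `f` gives an exact sequence `A / J → A / I → A / (I + (f)) → 0`.
theorem finrank_quotient_le_add {I J : Ideal A} [Module.Finite k (A ⧸ I)]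
    [Module.Finite k (A ⧸ J)] {f : A} (hf : ∀ x ∈ J, f * x ∈ I) :
    finrank k (A ⧸ I) ≤ finrank k (A ⧸ I ⊔ Ideal.span {f}) + finrank k (A ⧸ J) := by
  let mulf : A ⧸ J →ₗ[k] A ⧸ I :=
    (Submodule.mapQ J I (LinearMap.mulLeft A f) hf).restrictScalars k
  have hle : I ≤ I ⊔ Ideal.span {f} := le_sup_left
  let π : A ⧸ I →ₗ[k] A ⧸ I ⊔ Ideal.span {f} := (Ideal.Quotient.factorₐ k hle).toLinearMap
  have hπ : LinearMap.range π = ⊤ :=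
    LinearMap.range_eq_top.mpr (Ideal.Quotient.factor_surjective hle)
  have hker : LinearMap.ker π ≤ LinearMap.range mulf := by
    intro x hx
    obtain ⟨x, rfl⟩ := Ideal.Quotient.mk_surjective x
    have hx' : x ∈ I ⊔ Ideal.span {f} := Ideal.Quotient.eq_zero_iff_mem.mp hx
    obtain ⟨y, hy, _, hz, rfl⟩ := Submodule.mem_sup.mp hx'
    obtain ⟨w, rfl⟩ := Ideal.mem_span_singleton.mp hz
    exact ⟨Ideal.Quotient.mk J w, Ideal.Quotient.eq.mpr (by simpa using hy)⟩
  calc finrank k (A ⧸ I)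
      = finrank k (LinearMap.range π) + finrank k (LinearMap.ker π) :=
        (LinearMap.finrank_range_add_finrank_ker π).symm
    _ ≤ finrank k (A ⧸ I ⊔ Ideal.span {f}) + finrank k (A ⧸ J) := by
        rw [hπ, finrank_top]
        exact add_le_add_right ((Submodule.finrank_mono hker).trans mulf.finrank_range_le) _

/-- The hypothesis says that `B` is free over `A` along `φ`, with basis `c`. -/
theorem finrank_quotient_map_of_free {ι : Type*} [Fintype ι] (φ : A →ₐ[k] B) (c : ι → B)
    (Φ : (ι → A) ≃ₗ[k] B) (hΦ : ∀ g, Φ g = ∑ r, φ (g r) * c r) (I : Ideal A) :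
    finrank k (B ⧸ I.map φ) = Fintype.card ι * finrank k (A ⧸ I) := by
  classical
  set P : Submodule k (ι → A) := Submodule.pi Set.univ fun _ => I.restrictScalars k
  have hmap : P.map Φ.toLinearMap = (I.map φ).restrictScalars k := by
    apply le_antisymm
    · rintro _ ⟨g, hg, rfl⟩
      rw [LinearEquiv.coe_coe, hΦ]
      exact Ideal.sum_mem _ fun r _ => Ideal.mul_mem_right _ _
        (Ideal.mem_map_of_mem _ (hg r (Set.mem_univ r)))
    · intro x hx
      refine Submodule.closure_induction (p := fun x _ => x ∈ P.map Φ.toLinearMap)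
        (Submodule.zero_mem _) (fun _ _ _ _ => Submodule.add_mem _) ?_ hx
      rintro b _ ⟨f, hf, rfl⟩
      obtain ⟨g, rfl⟩ := Φ.surjective b
      refine ⟨fun r => f * g r, fun r _ => I.mul_mem_right _ hf, ?_⟩
      simp only [LinearEquiv.coe_coe, hΦ, map_mul, smul_eq_mul, Finset.sum_mul, mul_assoc,
        mul_comm (φ f)]
  have hquot : finrank k (B ⧸ I.map φ) = finrank k (ι → A ⧸ I) :=
    (Submodule.Quotient.equiv P _ Φ hmap).symm.finrank_eq.trans
      (Submodule.quotientPi fun _ : ι => I.restrictScalars k).finrank_eq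
  rw [hquot, finrank, rank_fun_eq_lift_mul]
  simp [finrank]

end Quotient

section ConstantCoeff

variable {k : Type*} [CommRing k] {σ : Type*}

theorem sub_C_constantCoeff_mem {J : Ideal (MvPolynomial σ k)}
    (hJ : ∀ i, X i ∈ J) (f : MvPolynomial σ k) : f - C (constantCoeff f) ∈ J := by
  induction f using MvPolynomial.induction_on with
  | C a => simp
  | add f g hf hg => simpa [add_sub_add_comm] using J.add_mem hf hg
  | mul_X f i _ => simpa using J.mul_mem_left f (hJ i)

theorem isNilpotent_mk_sub_algebraMap {I : Ideal (MvPolynomial σ k)}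
    (hI : ∀ i, IsNilpotent (Ideal.Quotient.mk I (X i))) (f : MvPolynomial σ k) :
    IsNilpotent (Ideal.Quotient.mk I f - algebraMap k _ (constantCoeff f)) :=
  sub_C_constantCoeff_mem (J := (nilradical _).comap (Ideal.Quotient.mk I)) hI f

theorem isIntegral_of_isNilpotent {R : Type*} [CommRing R] [Algebra k R] {x : R}
    (hx : IsNilpotent x) : IsIntegral k x := by
  obtain ⟨n, hn⟩ := hx
  exact .of_pow n.succ_pos (by simpa [pow_succ, hn] using isIntegral_zero)

theorem finite_quotient_of_isNilpotent_X [Finite σ]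
    {I : Ideal (MvPolynomial σ k)}
    (hI : ∀ i, IsNilpotent (Ideal.Quotient.mk I (X i))) :
    Module.Finite k (MvPolynomial σ k ⧸ I) := by
  have : Algebra.IsIntegral k (MvPolynomial σ k ⧸ I) := ⟨fun x => by
    obtain ⟨f, rfl⟩ := Ideal.Quotient.mk_surjective x
    simpa using (isIntegral_of_isNilpotent (isNilpotent_mk_sub_algebraMap hI f)).add
      (isIntegral_algebraMap (x := constantCoeff f))⟩
  exact Algebra.IsIntegral.finite

end ConstantCoeff

section Colength

variable {k : Type*} [Field k]

theorem isLocalRing_of_isNilpotent_sub {R : Type*} [CommRing R] [Nontrivial R] [Algebra k R]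
    (h : ∀ x : R, ∃ c : k, IsNilpotent (x - algebraMap k R c)) : IsLocalRing R := by
  have hunit : ∀ (x : R) {c : k}, c ≠ 0 → IsNilpotent (x - algebraMap k R c) → IsUnit x := by
    intro x c hc hx
    simpa using hx.isUnit_add_right_of_commute ((IsUnit.mk0 c hc).map (algebraMap k R))
      (Commute.all _ _)
  refine .of_isUnit_or_isUnit_one_sub_self fun x => ?_
  obtain ⟨c, hc⟩ := h x
  rcases eq_or_ne c 0 with rfl | hc0
  · right
    simpa using (show IsNilpotent x by simpa using hc).isUnit_one_sub
  · exact .inl (hunit x hc0 hc)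

theorem length_self_of_isNilpotent_sub {R : Type*} [CommRing R] [Algebra k R]
    (h : ∀ x : R, ∃ c : k, IsNilpotent (x - algebraMap k R c)) :
    length R R = length k R := by
  rcases subsingleton_or_nontrivial R with _ | _
  · simp
  have := isLocalRing_of_isNilpotent_sub h
  have hsurj : Function.Surjective
      (algebraMap (IsLocalRing.ResidueField k) (IsLocalRing.ResidueField R)) := by
    intro x
    obtain ⟨y, rfl⟩ := IsLocalRing.residue_surjective x
    obtain ⟨c, hc⟩ := h y
    refine ⟨IsLocalRing.residue k c, (sub_eq_zero.mp ?_).symm⟩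
    simpa using (hc.map (IsLocalRing.residue R)).eq_zero
  rw [IsLocalRing.length_restrictScalars k R R,
    length_eq_of_surjective (M := IsLocalRing.ResidueField R) hsurj,
    length_eq_one (IsLocalRing.ResidueField R), mul_one]

theorem colength_eq_finrank {σ : Type*} [Finite σ] {I : Ideal (MvPolynomial σ k)}
    (hI : ∀ i, IsNilpotent (Ideal.Quotient.mk I (X i))) :
    colength I = finrank k (MvPolynomial σ k ⧸ I) := by
  have := finite_quotient_of_isNilpotent_X hI
  have hnil : ∀ x : MvPolynomial σ k ⧸ I, ∃ c : k, IsNilpotent (x - algebraMap k _ c) := by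
    intro x
    obtain ⟨f, rfl⟩ := Ideal.Quotient.mk_surjective x
    exact ⟨_, isNilpotent_mk_sub_algebraMap hI f⟩
  calc colength I = length (MvPolynomial σ k ⧸ I) (MvPolynomial σ k ⧸ I) :=
        length_eq_of_surjective Ideal.Quotient.mk_surjective
    _ = length k (MvPolynomial σ k ⧸ I) := length_self_of_isNilpotent_sub hnil
    _ = finrank k (MvPolynomial σ k ⧸ I) := length_eq_finrank _ _

end Colength

section PowSubst

variable {k : Type*} [CommRing k] {σ : Type*}

/-- The substitution `x_i ↦ x_i ^ m_i`. -/
noncomputable def powSubst (k : Type*) [CommRing k] (m : σ → ℕ) :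
    MvPolynomial σ k →ₐ[k] MvPolynomial σ k :=
  aeval fun i => X i ^ m i

@[simp]
theorem powSubst_X (m : σ → ℕ) (i : σ) : powSubst k m (X i) = X i ^ m i :=
  aeval_X _ i

variable [Fintype σ]

/-- Division with remainder of exponent vectors by the vector `m`: the remainder `r` and the
quotient `a` correspond to the exponent vector `m a + r`. -/
noncomputable def exponentEquiv {m : σ → ℕ} (hm : ∀ i, 0 < m i) :
    (Σ _ : (∀ i, Fin (m i)), σ →₀ ℕ) ≃ (σ →₀ ℕ) where
  toFun x := Finsupp.equivFunOnFinite.symm fun i => m i * x.2 i + x.1 i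
  invFun a := ⟨fun i => ⟨a i % m i, Nat.mod_lt _ (hm i)⟩,
    Finsupp.equivFunOnFinite.symm fun i => a i / m i⟩
  left_inv := by
    rintro ⟨r, a⟩
    have hr : (fun i => (⟨(m i * a i + r i) % m i, Nat.mod_lt _ (hm i)⟩ : Fin (m i))) = r := by
      funext i
      ext
      simp [Nat.mod_eq_of_lt (r i).2]
    have ha : (Finsupp.equivFunOnFinite.symm fun i => (m i * a i + r i) / m i) = a := by
      ext i
      simp [Nat.mul_add_div (hm i), Nat.div_eq_of_lt (r i).2]
    exact Sigma.ext hr (heq_of_eq ha)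
  right_inv a := by
    ext i
    simp [Nat.div_add_mod]

theorem monomial_exponentEquiv {m : σ → ℕ} (hm : ∀ i, 0 < m i) (r : ∀ i, Fin (m i))
    (a : σ →₀ ℕ) : monomial (exponentEquiv hm ⟨r, a⟩) (1 : k) =
      powSubst k m (monomial a 1) * ∏ i, X i ^ (r i : ℕ) := by
  rw [monomial_eq, monomial_eq, Finsupp.prod_fintype _ _ (by simp),
    Finsupp.prod_fintype _ _ (by simp)]
  simp [exponentEquiv, pow_add, pow_mul, Finset.prod_mul_distrib]

section Coordinates

variable [DecidableEq σ]

/-- Along the substitution `x_i ↦ x_i ^ m_i` the polynomial ring is free over itself, with the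
monomials of exponents `r_i < m_i` as a basis; these are the coordinates in that basis. -/
noncomputable def powSubstEquiv (k : Type*) [CommRing k] {m : σ → ℕ} (hm : ∀ i, 0 < m i) :
    ((∀ i, Fin (m i)) → MvPolynomial σ k) ≃ₗ[k] MvPolynomial σ k :=
  (Pi.basis fun _ => basisMonomials σ k).equiv (basisMonomials σ k) (exponentEquiv hm)

theorem powSubstEquiv_apply {m : σ → ℕ} (hm : ∀ i, 0 < m i)
    (g : (∀ i, Fin (m i)) → MvPolynomial σ k) :
    powSubstEquiv k hm g = ∑ r, powSubst k m (g r) * ∏ i, X i ^ (r i : ℕ) := by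
  let Ψ : ((∀ i, Fin (m i)) → MvPolynomial σ k) →ₗ[k] MvPolynomial σ k :=
    ∑ r, LinearMap.mulRight k (∏ i, X i ^ (r i : ℕ)) ∘ₗ (powSubst k m).toLinearMap ∘ₗ
      LinearMap.proj r
  have hΨ : ∀ g, Ψ g = ∑ r, powSubst k m (g r) * ∏ i, X i ^ (r i : ℕ) := by simp [Ψ]
  suffices (powSubstEquiv k hm).toLinearMap = Ψ from (LinearMap.congr_fun this g).trans (hΨ g)
  refine (Pi.basis fun _ : (∀ i, Fin (m i)) => basisMonomials σ k).ext ?_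
  rintro ⟨r, a⟩
  simp only [hΨ, LinearEquiv.coe_coe, powSubstEquiv, Basis.equiv_apply, coe_basisMonomials,
    monomial_exponentEquiv]
  rw [Finset.sum_eq_single r]
  · simp
  · intro r' _ hr
    simp [Pi.single_eq_of_ne hr]
  · simp

end Coordinates

theorem finrank_quotient_map_powSubst {k : Type*} [Field k] {m : σ → ℕ} (hm : ∀ i, 0 < m i)
    (I : Ideal (MvPolynomial σ k)) :
    finrank k (MvPolynomial σ k ⧸ I.map (powSubst k m)) =
      (∏ i, m i) * finrank k (MvPolynomial σ k ⧸ I) := by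
  classical
  simpa using finrank_quotient_map_of_free (powSubst k m) _ (powSubstEquiv k hm)
    (powSubstEquiv_apply hm) I

end PowSubst

section PowIdeal

variable {k : Type*} [CommRing k] {σ : Type*}

/-- The ideal generated by `h` and the `x_i ^ b_i`. -/
noncomputable def powIdeal (h : MvPolynomial σ k) (b : σ → ℕ) : Ideal (MvPolynomial σ k) :=
  Ideal.span (insert h (Set.range fun i => X i ^ b i))

theorem self_mem_powIdeal (h : MvPolynomial σ k) (b : σ → ℕ) : h ∈ powIdeal h b :=
  Ideal.subset_span (Set.mem_insert _ _)

theorem X_pow_mem_powIdeal (h : MvPolynomial σ k) {b : σ → ℕ} {i : σ} {n : ℕ} (hn : b i ≤ n) :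
    X i ^ n ∈ powIdeal h b :=
  Ideal.mem_of_dvd _ (pow_dvd_pow _ hn) (Ideal.subset_span (Set.mem_insert_of_mem _ ⟨i, rfl⟩))

theorem powIdeal_le_iff {h : MvPolynomial σ k} {b : σ → ℕ} {J : Ideal (MvPolynomial σ k)} :
    powIdeal h b ≤ J ↔ h ∈ J ∧ ∀ i, X i ^ b i ∈ J := by
  simp [powIdeal, Ideal.span_le, Set.insert_subset_iff, Set.range_subset_iff]

theorem powIdeal_anti (h : MvPolynomial σ k) {b c : σ → ℕ} (hbc : b ≤ c) :
    powIdeal h c ≤ powIdeal h b :=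
  powIdeal_le_iff.mpr ⟨self_mem_powIdeal h b, fun i => X_pow_mem_powIdeal h (hbc i)⟩

theorem isNilpotent_mk_powIdeal_X (h : MvPolynomial σ k) (b : σ → ℕ) (i : σ) :
    IsNilpotent (Ideal.Quotient.mk (powIdeal h b) (X i)) :=
  ⟨b i, by
    rw [← map_pow]
    exact Ideal.Quotient.eq_zero_iff_mem.mpr (X_pow_mem_powIdeal h le_rfl)⟩

instance finite_quotient_powIdeal [Finite σ] (h : MvPolynomial σ k) (b : σ → ℕ) :
    Module.Finite k (MvPolynomial σ k ⧸ powIdeal h b) :=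
  finite_quotient_of_isNilpotent_X (isNilpotent_mk_powIdeal_X h b)

theorem map_powSubst_powIdeal (m : σ → ℕ) (h : MvPolynomial σ k) (b : σ → ℕ) :
    (powIdeal h b).map (powSubst k m) = powIdeal (powSubst k m h) fun i => m i * b i := by
  rw [powIdeal, Ideal.map_span, Set.image_insert_eq, ← Set.range_comp]
  simp [powIdeal, Function.comp_def, pow_mul]

end PowIdeal

section PowColength

variable {k : Type*} [Field k] {σ : Type*}

/-- The colength of the ideal generated by `h` and the `x_i ^ b_i`, as the dimension over the
ground field of the quotient. -/
noncomputable def powColength (h : MvPolynomial σ k) (b : σ → ℕ) : ℕ :=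
  finrank k (MvPolynomial σ k ⧸ powIdeal h b)

theorem powColength_pos [Finite σ] {h : MvPolynomial σ k} (hh : constantCoeff h = 0)
    {b : σ → ℕ} (hb : ∀ i, 0 < b i) : 0 < powColength h b := by
  have hle : powIdeal h b ≤ RingHom.ker (constantCoeff (σ := σ) (R := k)) :=
    powIdeal_le_iff.mpr ⟨hh, fun i => by simp [RingHom.mem_ker, (hb i).ne']⟩
  have : Nontrivial (MvPolynomial σ k ⧸ powIdeal h b) :=
    Ideal.Quotient.nontrivial_iff.mpr (ne_top_of_le_ne_top (RingHom.ker_ne_top _) hle)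
  exact finrank_pos

theorem powColength_mono [Finite σ] (h : MvPolynomial σ k) : Monotone (powColength h) :=
  fun _ _ hbc => finrank_quotient_anti (powIdeal_anti h hbc)

theorem powColength_update_le_add [Finite σ] [DecidableEq σ] (h : MvPolynomial σ k) (b : σ → ℕ)
    (i : σ) {n : ℕ} (hn : n ≤ b i + 1) :
    powColength h (Function.update b i n) ≤
      powColength h b + powColength h (Function.update b i 1) := by
  set c := Function.update b i n
  have hc : ∀ j, j ≠ i → X j ^ b j ∈ powIdeal h c := fun j hj =>
    X_pow_mem_powIdeal h (by simp [c, hj])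
  have hsup : powIdeal h b ≤ powIdeal h c ⊔ Ideal.span {X i ^ b i} := by
    refine powIdeal_le_iff.mpr ⟨Ideal.mem_sup_left (self_mem_powIdeal h c), fun j => ?_⟩
    rcases eq_or_ne j i with rfl | hj
    · exact Ideal.mem_sup_right (Ideal.mem_span_singleton_self _)
    · exact Ideal.mem_sup_left (hc j hj)
  have hmul : powIdeal h (Function.update b i 1) ≤
      Submodule.comap (LinearMap.mulLeft (MvPolynomial σ k) (X i ^ b i)) (powIdeal h c) := by
    refine powIdeal_le_iff.mpr ⟨Ideal.mul_mem_left _ _ (self_mem_powIdeal h c), fun j => ?_⟩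
    rcases eq_or_ne j i with rfl | hj
    · simpa [← pow_succ] using X_pow_mem_powIdeal h (b := c) (i := j) (by simpa [c] using hn)
    · simpa [hj] using Ideal.mul_mem_left _ _ (hc j hj)
  exact (finrank_quotient_le_add hmul).trans (add_le_add_left (finrank_quotient_anti hsup) _)

theorem powColength_one_le_one (h : MvPolynomial σ k) : powColength h 1 ≤ 1 := by
  refine finrank_le_one 1 fun x => ?_
  obtain ⟨f, rfl⟩ := Ideal.Quotient.mk_surjective x
  have hX : ∀ i, X i ∈ powIdeal h 1 := fun i => by
    simpa using X_pow_mem_powIdeal h (b := 1) (i := i) le_rfl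
  refine ⟨constantCoeff f, ?_⟩
  rw [← Algebra.algebraMap_eq_smul_one]
  exact (Ideal.Quotient.eq.mpr (sub_C_constantCoeff_mem hX f)).symm

variable [Fintype σ]

theorem powColength_powSubst {m : σ → ℕ} (hm : ∀ i, 0 < m i) (h : MvPolynomial σ k)
    (b : σ → ℕ) :
    powColength (powSubst k m h) (fun i => m i * b i) = (∏ i, m i) * powColength h b := by
  rw [powColength, ← map_powSubst_powIdeal, finrank_quotient_map_powSubst hm, powColength]

theorem powColength_le_prod (h : MvPolynomial σ k) {b : σ → ℕ} (hb : ∀ i, 0 < b i) :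
    powColength h b ≤ ∏ i, b i := by
  have hle : powIdeal 0 b ≤ powIdeal h b :=
    powIdeal_le_iff.mpr ⟨zero_mem _, fun i => X_pow_mem_powIdeal h le_rfl⟩
  calc powColength h b ≤ powColength 0 b := finrank_quotient_anti hle
    _ = (∏ i, b i) * powColength (0 : MvPolynomial σ k) 1 := by
        simpa using powColength_powSubst hb (0 : MvPolynomial σ k) 1
    _ ≤ ∏ i, b i := mul_le_of_le_one_right' (powColength_one_le_one 0)

end PowColength

section LinearColength

variable {k : Type*} [Field k] {σ : Type*} [Fintype σ]

/-- The dimension `D(b)` of `k[x] / (∑ x_i, x_i ^ b_i)`. -/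
noncomputable def linearColength (k : Type*) [Field k] (b : σ → ℕ) : ℕ :=
  powColength (∑ i, (X i : MvPolynomial σ k)) b

theorem linearColength_pos {b : σ → ℕ} (hb : ∀ i, 0 < b i) : 0 < linearColength k b :=
  powColength_pos (by simp) hb

theorem linearColength_mono : Monotone (linearColength k : (σ → ℕ) → ℕ) :=
  powColength_mono _

theorem powColength_sum_X_pow {d : σ → ℕ} (hd : ∀ i, 0 < d i) (b : σ → ℕ) :
    powColength (∑ i, (X i ^ d i : MvPolynomial σ k)) (fun i => d i * b i) =
      (∏ i, d i) * linearColength k b := by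
  simpa [linearColength] using powColength_powSubst hd (∑ i, (X i : MvPolynomial σ k)) b

section Elimination

variable [DecidableEq σ]

/-- The elimination of the variable `x_l` by means of the relation `∑ x_i = 0`. -/
noncomputable def elim (k : Type*) [CommRing k] (l : σ) :
    MvPolynomial σ k →ₐ[k] MvPolynomial {j // j ≠ l} k :=
  aeval fun j => if h : j = l then -∑ i, X i else X ⟨j, h⟩

@[simp]
theorem elim_X_self (l : σ) : elim k l (X l) = -∑ i, X i := by
  simp [elim]

@[simp]
theorem elim_X_coe {l : σ} (j : {j // j ≠ l}) : elim k l (X j) = X j := by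
  simp [elim, j.2]

theorem powIdeal_sum_X_le_comap_elim (l : σ) (b : σ → ℕ) :
    powIdeal (∑ i, X i) b ≤
      (powIdeal ((∑ j : {j // j ≠ l}, X j) ^ b l) fun j => b j).comap (elim k l) := by
  refine powIdeal_le_iff.mpr ⟨?_, fun j => ?_⟩
  · simp [Fintype.sum_eq_add_sum_subtype_ne _ l]
  · rcases eq_or_ne j l with rfl | hj
    · rw [Ideal.mem_comap, map_pow, elim_X_self, neg_pow]
      exact Ideal.mul_mem_left _ _ (self_mem_powIdeal _ _)
    · rw [Ideal.mem_comap, map_pow, elim_X_coe ⟨j, hj⟩]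
      exact X_pow_mem_powIdeal (i := (⟨j, hj⟩ : {j // j ≠ l})) _ le_rfl

theorem mk_rename_sum_X (l : σ) (b : σ → ℕ) :
    Ideal.Quotient.mk (powIdeal (∑ i, X i) b)
      (rename Subtype.val (∑ j : {j // j ≠ l}, (X j : MvPolynomial _ k))) =
        Ideal.Quotient.mk _ (-X l) := by
  have hsum : (∑ i, X i : MvPolynomial σ k) =
      rename Subtype.val (∑ j : {j // j ≠ l}, X j) + X l := by
    simp [Fintype.sum_eq_add_sum_subtype_ne _ l, add_comm]
  rw [Ideal.Quotient.eq, sub_neg_eq_add, ← hsum]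
  exact self_mem_powIdeal _ b

theorem powIdeal_le_comap_rename (l : σ) (b : σ → ℕ) :
    powIdeal ((∑ j : {j // j ≠ l}, X j) ^ b l) (fun j => b j) ≤
      (powIdeal (∑ i, X i) b).comap (rename Subtype.val :
        MvPolynomial {j // j ≠ l} k →ₐ[k] MvPolynomial σ k) := by
  refine powIdeal_le_iff.mpr ⟨?_, fun j => ?_⟩
  · rw [Ideal.mem_comap, ← Ideal.Quotient.eq_zero_iff_mem, map_pow, map_pow, mk_rename_sum_X,
      ← map_pow, Ideal.Quotient.eq_zero_iff_mem, neg_pow]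
    exact Ideal.mul_mem_left _ _ (X_pow_mem_powIdeal _ le_rfl)
  · rw [Ideal.mem_comap, map_pow, rename_X]
    exact X_pow_mem_powIdeal _ le_rfl

theorem linearColength_eq_powColength_sum_pow (l : σ) (b : σ → ℕ) :
    linearColength k b =
      powColength ((∑ j : {j // j ≠ l}, (X j : MvPolynomial _ k)) ^ b l) (fun j => b j) := by
  refine (AlgEquiv.ofAlgHom
    (Ideal.quotientMapₐ _ (elim k l) (powIdeal_sum_X_le_comap_elim l b))
    (Ideal.quotientMapₐ _ (rename Subtype.val) (powIdeal_le_comap_rename l b))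
    (Ideal.Quotient.algHom_ext _ (algHom_ext fun j => ?_))
    (Ideal.Quotient.algHom_ext _ (algHom_ext fun j => ?_))).toLinearEquiv.finrank_eq
  · simp
  · rcases eq_or_ne j l with rfl | hj
    · simpa using congrArg Neg.neg (mk_rename_sum_X (k := k) j b)
    · simp [elim_X_coe ⟨j, hj⟩]

end Elimination

theorem linearColength_prime_mul {p : ℕ} [Fact p.Prime] [CharP k p] [Nonempty σ] (b : σ → ℕ) :
    linearColength k (fun i => p * b i) = p ^ (Fintype.card σ - 1) * linearColength k b := by
  classical
  obtain ⟨l⟩ := ‹Nonempty σ›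
  have hfrob : powSubst k (fun _ => p) ((∑ j : {j // j ≠ l}, X j) ^ b l) =
      (∑ j : {j // j ≠ l}, X j) ^ (p * b l) := by
    simp [pow_mul, sum_pow_char]
  have hp : 0 < p := (Fact.out : p.Prime).pos
  rw [linearColength_eq_powColength_sum_pow l, linearColength_eq_powColength_sum_pow l, ← hfrob,
    powColength_powSubst fun _ => hp]
  simp [Fintype.card_subtype_compl]

theorem linearColength_update_one_le [DecidableEq σ] (hσ : 2 ≤ Fintype.card σ) {b : σ → ℕ} {q : ℕ}
    (hq : 0 < q) (hb : ∀ j, b j ≤ q) (i : σ) :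
    linearColength k (Function.update b i 1) ≤ q ^ (Fintype.card σ - 2) := by
  have : Nontrivial σ := Fintype.one_lt_card_iff_nontrivial.mp hσ
  obtain ⟨l, hl⟩ := exists_ne i
  let c : {j // j ≠ l} → ℕ := Function.update (fun _ => q) ⟨i, hl.symm⟩ 1
  have hbc : (fun j : {j // j ≠ l} => Function.update b i 1 j) ≤ c := fun j => by
    rcases eq_or_ne j.1 i with rfl | hj
    · simp [c]
    · simp [c, hj, Subtype.ext_iff, hb]
  have hc : ∀ j, 0 < c j := Function.forall_update_iff _ _ |>.mpr ⟨one_pos, fun _ _ => hq⟩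
  rw [linearColength_eq_powColength_sum_pow l]
  calc _ ≤ powColength _ c := powColength_mono _ hbc
    _ ≤ ∏ j, c j := powColength_le_prod _ hc
    _ = q ^ (Fintype.card σ - 2) := by
        simp [c, Finset.prod_update_of_mem, Finset.card_sdiff, Fintype.card_subtype_compl,
          Nat.sub_sub]

theorem linearColength_le_add_card_mul (hσ : 2 ≤ Fintype.card σ) {b c : σ → ℕ} {q : ℕ}
    (hq : 0 < q) (hcb : ∀ j, c j ≤ b j + 1) (hb : ∀ j, b j ≤ q) (hc : ∀ j, c j ≤ q) :
    linearColength k c ≤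
      linearColength k b + Fintype.card σ * q ^ (Fintype.card σ - 2) := by
  classical
  suffices ∀ S : Finset σ, linearColength k (S.piecewise c b) ≤
      linearColength k b + S.card * q ^ (Fintype.card σ - 2) by
    simpa using this Finset.univ
  intro S
  induction S using Finset.induction_on with
  | empty => simp
  | insert i S hi ih =>
    have hbi : c i ≤ S.piecewise c b i + 1 := by simpa [hi] using hcb i
    have hle : ∀ j, S.piecewise c b j ≤ q := S.piecewise_le_of_le_of_le hc hb
    calc linearColength k ((insert i S).piecewise c b)
        ≤ linearColength k (S.piecewise c b) +
            linearColength k (Function.update (S.piecewise c b) i 1) := by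
          rw [Finset.piecewise_insert]
          exact powColength_update_le_add _ _ _ hbi
      _ ≤ linearColength k b + S.card * q ^ (Fintype.card σ - 2) + q ^ (Fintype.card σ - 2) :=
          add_le_add ih (linearColength_update_one_le hσ hq hle i)
      _ = linearColength k b + (insert i S).card * q ^ (Fintype.card σ - 2) := by
          rw [Finset.card_insert_of_notMem hi]
          ring

end LinearColength

section Diagonal

variable {k : Type*} [Field k] {σ : Type*} [Fintype σ] {d : σ → ℕ}

theorem prod_mul_linearColength_floor_le (hd : ∀ i, 0 < d i) (q : ℕ) :
    (∏ i, d i) * linearColength k (fun i => q / d i) ≤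
      powColength (∑ i, (X i ^ d i : MvPolynomial σ k)) fun _ => q := by
  rw [← powColength_sum_X_pow hd]
  exact powColength_mono _ fun i => Nat.mul_div_le q (d i)

theorem powColength_le_prod_mul_linearColength_ceil (hd : ∀ i, 0 < d i) (q : ℕ) :
    powColength (∑ i, (X i ^ d i : MvPolynomial σ k)) (fun _ => q) ≤
      (∏ i, d i) * linearColength k fun i => q ⌈/⌉ d i := by
  rw [← powColength_sum_X_pow hd]
  exact powColength_mono _ fun i => le_smul_ceilDiv (hd i)

theorem linearColength_ceil_le_floor_add (hσ : 2 ≤ Fintype.card σ) (hd : ∀ i, 0 < d i) {q : ℕ}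
    (hq : 0 < q) :
    linearColength k (fun i => q ⌈/⌉ d i) ≤
      linearColength k (fun i => q / d i) + Fintype.card σ * q ^ (Fintype.card σ - 2) :=
  linearColength_le_add_card_mul hσ hq
    (fun i => (ceilDiv_le_iff_le_mul (hd i)).mpr (Nat.lt_mul_div_succ q (hd i)).le)
    (fun i => Nat.div_le_self q (d i))
    fun i => (ceilDiv_le_iff_le_mul (hd i)).mpr (Nat.le_mul_of_pos_left q (hd i))

variable {p : ℕ} [Fact p.Prime] [CharP k p]

theorem pow_mul_linearColength_floor_le [Nonempty σ] (d : σ → ℕ) (q : ℕ) :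
    p ^ (Fintype.card σ - 1) * linearColength k (fun i => q / d i) ≤
      linearColength k fun i => p * q / d i := by
  rw [← linearColength_prime_mul]
  exact linearColength_mono fun i => Nat.mul_div_le_mul_div_assoc p q (d i)

theorem linearColength_ceil_le_pow_mul [Nonempty σ] (hd : ∀ i, 0 < d i) (q : ℕ) :
    linearColength k (fun i => (p * q) ⌈/⌉ d i) ≤
      p ^ (Fintype.card σ - 1) * linearColength k fun i => q ⌈/⌉ d i := by
  rw [← linearColength_prime_mul]
  refine linearColength_mono fun i => (ceilDiv_le_iff_le_mul (hd i)).mpr ?_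
  rw [mul_left_comm]
  exact Nat.mul_le_mul_left p (le_smul_ceilDiv (hd i))

theorem exists_linearColength_floor_pos (k : Type*) [Field k] (hd : ∀ i, 0 < d i) {p : ℕ}
    (hp : 1 < p) : ∃ n, 0 < linearColength k fun i => p ^ n / d i := by
  refine ⟨∑ i, d i, linearColength_pos fun i => Nat.div_pos ?_ (hd i)⟩
  exact (Finset.single_le_sum_of_canonicallyOrdered (Finset.mem_univ i)).trans
    (Nat.lt_pow_self hp).le

end Diagonal

section Squeeze

theorem monotone_div_pow {Q : ℝ} (hQ : 0 < Q) {a : ℕ → ℝ} (h : ∀ n, Q * a n ≤ a (n + 1)) :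
    Monotone fun n => a n / Q ^ n :=
  monotone_nat_of_le_succ fun n => by
    rw [pow_succ', ← mul_div_mul_left (a n) _ hQ.ne']
    gcongr
    exact h n

theorem antitone_div_pow {Q : ℝ} (hQ : 0 < Q) {a : ℕ → ℝ} (h : ∀ n, a (n + 1) ≤ Q * a n) :
    Antitone fun n => a n / Q ^ n :=
  antitone_nat_of_succ_le fun n => by
    rw [pow_succ', ← mul_div_mul_left (a n) _ hQ.ne']
    gcongr
    exact h n

theorem exists_pos_forall_abs_sub_le {l u x ε : ℕ → ℝ} (hl : Monotone l) (hu : Antitone u)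
    (hlx : l ≤ x) (hxu : x ≤ u) (hε : u - l ≤ ε) (hpos : ∃ n, 0 < l n) :
    ∃ μ, 0 < μ ∧ ∀ n, |x n - μ| ≤ ε n := by
  have hμ : ∀ n, ⨆ m, l m ∈ Set.Icc (l n) (u n) :=
    Set.mem_iInter.mp (hl.ciSup_mem_iInter_Icc_of_antitone hu (hlx.trans hxu))
  obtain ⟨n₀, hn₀⟩ := hpos
  exact ⟨⨆ m, l m, hn₀.trans_le (hμ n₀).1, fun n =>
    (Real.dist_le_of_mem_Icc ⟨hlx n, hxu n⟩ (hμ n)).trans (hε n)⟩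

theorem exists_pos_forall_abs_div_pow_sub_le {p s C : ℕ} (hp : 0 < p) (hs : 2 ≤ s)
    {lo x up : ℕ → ℕ} (hlo : ∀ n, p ^ (s - 1) * lo n ≤ lo (n + 1))
    (hup : ∀ n, up (n + 1) ≤ p ^ (s - 1) * up n) (hlx : lo ≤ x) (hxu : x ≤ up)
    (hgap : ∀ n, up n ≤ lo n + C * (p ^ n) ^ (s - 2)) (hpos : ∃ n, 0 < lo n) :
    ∃ μ : ℝ, 0 < μ ∧ ∀ n, |(x n : ℝ) / ((p : ℝ) ^ n) ^ (s - 1) - μ| ≤ C / (p : ℝ) ^ n := by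
  have hQ : (0 : ℝ) < (p : ℝ) ^ (s - 1) := by positivity
  have hl : Monotone fun n => (lo n : ℝ) / ((p : ℝ) ^ (s - 1)) ^ n :=
    monotone_div_pow hQ fun n => by exact_mod_cast hlo n
  have hu : Antitone fun n => (up n : ℝ) / ((p : ℝ) ^ (s - 1)) ^ n :=
    antitone_div_pow hQ fun n => by exact_mod_cast hup n
  simp only [pow_right_comm _ _ (s - 1)]
  refine exists_pos_forall_abs_sub_le hl hu
    (fun n => div_le_div_of_nonneg_right (Nat.cast_le.mpr (hlx n)) (by positivity))
    (fun n => div_le_div_of_nonneg_right (Nat.cast_le.mpr (hxu n)) (by positivity))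
    (fun n => ?_) ?_
  · have hgap' : (up n : ℝ) - lo n ≤ C * ((p : ℝ) ^ n) ^ (s - 2) := by
      rw [sub_le_iff_le_add']
      exact_mod_cast hgap n
    have hpow : ((p : ℝ) ^ (s - 1)) ^ n = ((p : ℝ) ^ n) ^ (s - 2) * (p : ℝ) ^ n := by
      rw [← pow_succ, pow_right_comm, show s - 2 + 1 = s - 1 by lia]
    calc (up n : ℝ) / ((p : ℝ) ^ (s - 1)) ^ n - lo n / ((p : ℝ) ^ (s - 1)) ^ n
        = (up n - lo n) / ((p : ℝ) ^ (s - 1)) ^ n := (sub_div _ _ _).symm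
      _ ≤ C * ((p : ℝ) ^ n) ^ (s - 2) / ((p : ℝ) ^ (s - 1)) ^ n := by gcongr
      _ = C / (p : ℝ) ^ n := by
          rw [hpow]
          field_simp
  · obtain ⟨n, hn⟩ := hpos
    exact ⟨n, by positivity⟩

end Squeeze

section Multiplicity

theorem exists_pos_forall_abs_powColength_sub_le (k : Type*) [Field k] {p : ℕ} [Fact p.Prime]
    [CharP k p] {σ : Type*} [Fintype σ] (hσ : 2 ≤ Fintype.card σ) {d : σ → ℕ}
    (hd : ∀ i, 0 < d i) :
    ∃ μ : ℝ, 0 < μ ∧ ∀ n : ℕ,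
      |(powColength (∑ i, (X i ^ d i : MvPolynomial σ k)) (fun _ => p ^ n) : ℝ) /
        ((p : ℝ) ^ n) ^ (Fintype.card σ - 1) - μ| ≤
          (((∏ i, d i) * Fintype.card σ : ℕ) : ℝ) / (p : ℝ) ^ n := by
  have hp : p.Prime := Fact.out
  have : Nonempty σ := Fintype.card_pos_iff.mp (by lia)
  obtain ⟨n₀, hn₀⟩ := exists_linearColength_floor_pos k hd hp.one_lt
  refine exists_pos_forall_abs_div_pow_sub_le hp.pos hσ
    (lo := fun n => (∏ i, d i) * linearColength k fun i => p ^ n / d i)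
    (up := fun n => (∏ i, d i) * linearColength k fun i => p ^ n ⌈/⌉ d i)
    (fun n => ?_) (fun n => ?_) (fun n => prod_mul_linearColength_floor_le hd _)
    (fun n => powColength_le_prod_mul_linearColength_ceil hd _) (fun n => ?_)
    ⟨n₀, Nat.mul_pos (Finset.prod_pos fun i _ => hd i) hn₀⟩
  · rw [mul_left_comm, pow_succ']
    exact Nat.mul_le_mul_left _ (pow_mul_linearColength_floor_le d _)
  · rw [mul_left_comm, pow_succ']
    exact Nat.mul_le_mul_left _ (linearColength_ceil_le_pow_mul hd _)
  · rw [mul_assoc, ← mul_add]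
    exact Nat.mul_le_mul_left _ (linearColength_ceil_le_floor_add hσ hd (pow_pos hp.pos n))

variable {p s : ℕ}

theorem e_eq_powColength [Fact p.Prime] (n : ℕ) (h : MvPolynomial (Fin s) (ZMod p)) :
    e n h = powColength h fun _ => p ^ n := by
  rw [e, show frobIdeal h n = powIdeal h fun _ => p ^ n from rfl,
    colength_eq_finrank (isNilpotent_mk_powIdeal_X h _), ENat.toNat_natCast, powColength]

theorem multiplicity_diagonal_pos_and_abs_sub_le (hp : p.Prime) (hs : 2 ≤ s) {d : Fin s → ℕ}
    (hd : ∀ i, 0 < d i) :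
    0 < multiplicity (diagonal p d) ∧
      ∀ n, |(e n (diagonal p d) : ℝ) / ((p : ℝ) ^ n) ^ (s - 1) - multiplicity (diagonal p d)| ≤
        ((∏ i, d i : ℕ) : ℝ) * s / (p : ℝ) ^ n := by
  have := Fact.mk hp
  obtain ⟨μ, hμ, hbound⟩ : ∃ μ : ℝ, 0 < μ ∧ ∀ n, |(e n (diagonal p d) : ℝ) /
      ((p : ℝ) ^ n) ^ (s - 1) - μ| ≤ ((∏ i, d i : ℕ) : ℝ) * s / (p : ℝ) ^ n := by
    simpa [e_eq_powColength, diagonal] using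
      exists_pos_forall_abs_powColength_sub_le (ZMod p) (p := p) (by simpa using hs) hd
  have herror : Tendsto (fun n : ℕ => ((∏ i, d i : ℕ) : ℝ) * s / (p : ℝ) ^ n) atTop (𝓝 0) :=
    tendsto_const_nhds.div_atTop
      (tendsto_pow_atTop_atTop_of_one_lt (by exact_mod_cast hp.one_lt))
  have hlim : Tendsto (fun n => (e n (diagonal p d) : ℝ) / ((p : ℝ) ^ n) ^ (s - 1)) atTop (𝓝 μ) :=
    tendsto_iff_dist_tendsto_zero.mpr (squeeze_zero (fun _ => dist_nonneg) hbound herror)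
  rw [multiplicity, hlim.limUnder_eq]
  exact ⟨hμ, hbound⟩

theorem isMultiplicity_of_abs_sub_le (hp : 0 < p) (hs : 2 ≤ s)
    {h : MvPolynomial (Fin s) (ZMod p)} {μ C : ℝ} (hμ : 0 < μ)
    (hC : ∀ n, |(e n h : ℝ) / ((p : ℝ) ^ n) ^ (s - 1) - μ| ≤ C / (p : ℝ) ^ n) :
    IsMultiplicity h μ := by
  refine ⟨hμ, IsBigO.of_bound C (Eventually.of_forall fun n => ?_)⟩
  set q : ℝ := (p : ℝ) ^ n
  have hq : 0 < q := by positivity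
  have hpow : q ^ (s - 1) = q ^ (s - 2) * q := by
    rw [← pow_succ, show s - 2 + 1 = s - 1 by lia]
  calc ‖(e n h : ℝ) - μ * q ^ (s - 1)‖ = |(e n h : ℝ) / q ^ (s - 1) - μ| * q ^ (s - 1) := by
        rw [Real.norm_eq_abs, ← abs_of_pos (pow_pos hq (s - 1)), ← abs_mul,
          abs_of_pos (pow_pos hq (s - 1)), sub_mul, div_mul_cancel₀ _ (pow_pos hq _).ne']
    _ ≤ C / q * q ^ (s - 1) := by gcongr; exact hC n
    _ = C * ‖q ^ (s - 2)‖ := by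
        rw [Real.norm_of_nonneg (by positivity), hpow]
        field_simp

end Multiplicity

end HilbertKunz

theorem theorem1p4 (s : ℕ) (hs : 2 ≤ s) (d : Fin s → ℕ) (hd : ∀ i, 1 < d i) :
    (∀ p : ℕ, p.Prime →
      HilbertKunz.IsMultiplicity (HilbertKunz.diagonal p d)
        (HilbertKunz.multiplicity (HilbertKunz.diagonal p d)) ∧
      |(HilbertKunz.e 1 (HilbertKunz.diagonal p d) : ℝ) / (p : ℝ) ^ (s - 1) -
        HilbertKunz.multiplicity (HilbertKunz.diagonal p d)| ≤
          ((∏ i, d i : ℕ) : ℝ) * (s : ℝ) / (p : ℝ)) ∧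
    ∀ L : ℝ,
      Tendsto (fun p : ℕ =>
          (HilbertKunz.e 1 (HilbertKunz.diagonal p d) : ℝ) / (p : ℝ) ^ (s - 1))
        HilbertKunz.primesAtTop (𝓝 L) →
      Tendsto (fun p : ℕ => HilbertKunz.multiplicity (HilbertKunz.diagonal p d))
        HilbertKunz.primesAtTop (𝓝 L) := by
  have hmult := fun (p : ℕ) (hp : p.Prime) =>
    HilbertKunz.multiplicity_diagonal_pos_and_abs_sub_le hp hs fun i => zero_lt_one.trans (hd i)
  have hbound : ∀ p : ℕ, p.Prime →
      |(HilbertKunz.e 1 (HilbertKunz.diagonal p d) : ℝ) / (p : ℝ) ^ (s - 1) -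
        HilbertKunz.multiplicity (HilbertKunz.diagonal p d)| ≤
          ((∏ i, d i : ℕ) : ℝ) * (s : ℝ) / (p : ℝ) := fun p hp => by
    simpa using (hmult p hp).2 1
  refine ⟨fun p hp => ⟨HilbertKunz.isMultiplicity_of_abs_sub_le hp.pos hs (hmult p hp).1
    (hmult p hp).2, hbound p hp⟩, fun L hL => ?_⟩
  have herror : Tendsto (fun p : ℕ => ((∏ i, d i : ℕ) : ℝ) * (s : ℝ) / (p : ℝ))
      HilbertKunz.primesAtTop (𝓝 0) :=
    (tendsto_const_div_atTop_nhds_zero_nat _).mono_left inf_le_left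
  have hdiff : Tendsto (fun p : ℕ =>
      (HilbertKunz.e 1 (HilbertKunz.diagonal p d) : ℝ) / (p : ℝ) ^ (s - 1) -
        HilbertKunz.multiplicity (HilbertKunz.diagonal p d)) HilbertKunz.primesAtTop (𝓝 0) :=
    squeeze_zero_norm' (eventually_inf_principal.mpr (Eventually.of_forall hbound)) herror
  simpa using hL.sub hdiff
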